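/- Let $r,N\ge 1$, let $\mathbb U=\mathbb R^{m_1\times\cdots\times m_r}$ and $\mathbb V=\mathbb R^{n_1\times\cdots\times n_r}$ carry the entrywise (Frobenius) inner product, and let $A_k\in\mathbb R^{n_k\times m_k}$ for $k=1,\dots,r$. Write $\boldsymbol A=(A_1,\dots,A_r)$, let $\mathsf F_{\boldsymbol A}:\mathbb U\to\mathbb V$ be the Tucker map $$(\mathsf F_{\boldsymbol A}T)_{i_1,\dots,i_r}=\sum_{j_1,\dots,j_r}(A_1)_{i_1j_1}\cdots(A_r)_{i_rj_r}T_{j_1,\dots,j_r},$$ and let $\|\boldsymbol A\|:=\prod_{k=1}^r\|A_k\|$ be the product of the spectral norms. For a linear map $\mathsf M:\mathbb V\to\mathbb V$ let $$\|\mathsf M\|_{\rm ml}:=\max\bigl\{\langle \mathsf M(u_1\otimes\cdots\otimes u_r),v_1\otimes\cdots\otimes v_r\rangle:\ u_k,v_k\in\mathbb R^{n_k},\ \|u_k\|\le1,\ \|v_k\|\le 1\bigr\}.$$ Let $\sigma\ge0$, $\nu\in\mathbb U$, $\mu=\mathsf F_{\boldsymbol A}\nu$, and let $X_1,\dots,X_N$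 be independent random tensors in $\mathbb V$, each following the probabilistic tensor PCA (TPCA) model $X=\mu+\mathsf F_{\boldsymbol A}Z+\varepsilon$, where $Z$ is standard Gaussian in $\mathbb U$, $\varepsilon$ is Gaussian in $\mathbb V$ with mean zero and covariance $\sigma^2\mathbb I_{\mathbb V}$, and $Z$ and $\varepsilon$ are independent. Put $$\Sigma=\sigma^2\mathbb I_{\mathbb V}+\mathsf F_{\boldsymbol A}\mathsf F_{\boldsymbol A}^*,\qquad \mathsf S_N=\frac1N\sum_{i=1}^N(X_i-\mu)\otimes(X_i-\mu),$$ where $S\otimes T$ denotes the operator $W\mapsto\langle T,W\rangle S$. Then for all $\delta_1,\delta_2,\delta_3>0$, with probability at least $1-\delta_1-\delta_2-\delta_3$, $$\|\mathsf S_N-\Sigma\|_{\rm ml}\le t_1+t_2+t_3,$$ where (with $\max\{\alpha,\sqrt\alpha\}$ read as $0$ if $\alpha<0$) $$t_1=2\sigma^2\max\{\alpha_1,\sqrt{\alpha_1}\},\qquad \alpha_1=\frac1{0.145\,N}\Bigl(2\log(10r)\sum_{k=1}^r n_k+\log\tfrac1{\delta_1}\Bigr),$$ $$t_2=2\|\boldsymbol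 A\|^2\max\{\alpha_2,\sqrt{\alpha_2}\},\qquad \alpha_2=\frac1{0.145\,N}\Bigl(2\log(10r)\sum_{k=1}^r m_k+\log\tfrac1{\delta_2}\Bigr),$$ $$t_3=4\sigma\|\boldsymbol A\|\max\{\alpha_3,\sqrt{\alpha_3}\},\qquad \alpha_3=\frac3N\Bigl(\log(10r)\sum_{k=1}^r(n_k+m_k)+\log\tfrac1{\delta_3}\Bigr).$$ -/

import Mathlib

open MeasureTheory ProbabilityTheory

noncomputable section

namespace TPCA

/-- The space of real arrays of size `n 0 × ⋯ × n (r - 1)`, with the entrywise inner product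
`⟪S, T⟫ = ∑ i, S i * T i` and the Frobenius norm. -/
abbrev Tensor {r : ℕ} (n : Fin r → ℕ) : Type :=
  EuclideanSpace ℝ ((k : Fin r) → Fin (n k))

variable {r : ℕ} {m n : Fin r → ℕ}

/-- The rank-one tensor `v₁ ⊗ ⋯ ⊗ vᵣ`, with entries `∏ k, (v k) (i k)`. -/
def rankOne (v : (k : Fin r) → EuclideanSpace ℝ (Fin (n k))) : Tensor n :=
  WithLp.toLp 2 fun i => ∏ k, v k (i k)

/-- The set of rank-one tensors `v₁ ⊗ ⋯ ⊗ vᵣ` with `‖v k‖ ≤ 1` for every `k`. -/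
def rankOneBall (n : Fin r → ℕ) : Set (Tensor n) :=
  {T | ∃ v : (k : Fin r) → EuclideanSpace ℝ (Fin (n k)), (∀ k, ‖v k‖ ≤ 1) ∧ T = rankOne v}

/-- The values `⟪F u, v⟫` for `u`, `v` in the two rank-one balls. -/
def mlValues (F : Tensor m →ₗ[ℝ] Tensor n) : Set ℝ :=
  {x | ∃ u ∈ rankOneBall m, ∃ v ∈ rankOneBall n, x = inner ℝ (F u) v}

/-- The multilinear spectral norm `‖F‖_ml`, the maximum of `⟪F u, v⟫` over rank-one tensors
`u`, `v` whose factors have norm at most one. -/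
def mlNorm (F : Tensor m →ₗ[ℝ] Tensor n) : ℝ :=
  sSup (mlValues F)

theorem isCompact_rankOneBall (n : Fin r → ℕ) : IsCompact (rankOneBall n) := by
  have h : rankOneBall n = rankOne '' (Set.univ.pi fun k =>
      Metric.closedBall (0 : EuclideanSpace ℝ (Fin (n k))) 1) := by
    ext T
    simp only [rankOneBall, Set.mem_ofPred_eq, Set.mem_image, Set.mem_pi, Set.mem_univ,
      forall_true_left, mem_closedBall_zero_iff]
    exact ⟨fun ⟨v, hv, h⟩ => ⟨v, hv, h.symm⟩, fun ⟨v, hv, h⟩ => ⟨v, hv, h.symm⟩⟩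
  rw [h]
  refine (isCompact_univ_pi fun k => isCompact_closedBall _ _).image ?_
  unfold rankOne
  fun_prop

/-- The supremum in `mlNorm` is a maximum. -/
theorem isGreatest_mlNorm (F : Tensor m →ₗ[ℝ] Tensor n) : IsGreatest (mlValues F) (mlNorm F) := by
  have h : mlValues F = (fun p : Tensor m × Tensor n => inner ℝ (F p.1) p.2) ''
      (rankOneBall m ×ˢ rankOneBall n) := by
    ext x
    simp only [mlValues, Set.mem_ofPred_eq, Set.mem_image, Set.mem_prod, Prod.exists]
    exact ⟨fun ⟨u, hu, v, hv, h⟩ => ⟨u, v, ⟨hu, hv⟩, h.symm⟩,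
      fun ⟨u, v, ⟨hu, hv⟩, h⟩ => ⟨u, hu, v, hv, h.symm⟩⟩
  have hF : Continuous F := F.continuous_of_finiteDimensional
  have hc : IsCompact (mlValues F) := by
    rw [h]
    exact ((isCompact_rankOneBall m).prod (isCompact_rankOneBall n)).image (by fun_prop)
  refine hc.isGreatest_sSup ⟨_, rankOne 0, ⟨0, by simp, rfl⟩, rankOne 0, ⟨0, by simp, rfl⟩, rfl⟩

/-- The Tucker map `F_A : T ↦ A · T`, with
`(A · T) i = ∑ j, (A 0) (i 0) (j 0) ⋯ (A (r-1)) (i (r-1)) (j (r-1)) * T j`. -/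
def tucker (A : (k : Fin r) → Matrix (Fin (n k)) (Fin (m k)) ℝ) : Tensor m →ₗ[ℝ] Tensor n where
  toFun T := WithLp.toLp 2 fun i => ∑ j : (k : Fin r) → Fin (m k), (∏ k, A k (i k) (j k)) * T j
  map_add' S T := by
    ext i
    simp [mul_add, Finset.sum_add_distrib]
  map_smul' c T := by
    ext i
    simp [Finset.mul_sum, mul_left_comm]

/-- The spectral norm (Euclidean operator norm) of a real matrix. -/
def specNorm {a b : ℕ} (M : Matrix (Fin a) (Fin b) ℝ) : ℝ :=
  ‖(Matrix.toEuclideanLin M).toContinuousLinearMap‖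

/-- `‖A‖ = ∏ k, ‖A k‖`, the product of the spectral norms of the factor matrices. -/
def prodNorm (A : (k : Fin r) → Matrix (Fin (n k)) (Fin (m k)) ℝ) : ℝ :=
  ∏ k, specNorm (A k)

/-- The operator `S ⊗ T`, that is `W ↦ ⟪T, W⟫ S`. -/
def outer (S : Tensor n) (T : Tensor m) : Tensor m →ₗ[ℝ] Tensor n :=
  (innerₗ (Tensor m) T).smulRight S

variable {Ω : Type*} [MeasurableSpace Ω]

/-- The random tensor `X` is Gaussian with mean `μ` and (positive semidefinite) covariance
operator `C`: every `⟪X, T⟫` is normal with mean `⟪μ, T⟫` and variance `⟪C T, T⟫`. -/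
structure IsGaussian (P : Measure Ω) (X : Ω → Tensor n) (μ : Tensor n)
    (C : Tensor n →ₗ[ℝ] Tensor n) : Prop where
  isPositive : C.IsPositive
  hasLaw : ∀ T : Tensor n, HasLaw (fun ω => inner ℝ (X ω) T)
    (gaussianReal (inner ℝ μ T) (inner ℝ (C T) T).toNNReal) P

/-- The random tensor `X` follows the probabilistic tensor PCA model with factor matrices `A`,
mean `A · ν` and noise level `σ`: `X = A · ν + A · Z + ε` with independent `Z ∼ N(0, I)` and
`ε ∼ N(0, σ² I)`. -/
def FollowsModel (P : Measure Ω) (A : (k : Fin r) → Matrix (Fin (n k)) (Fin (m k)) ℝ)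
    (ν : Tensor m) (σ : ℝ) (X : Ω → Tensor n) : Prop :=
  ∃ (Z : Ω → Tensor m) (ε : Ω → Tensor n),
    IsGaussian P Z 0 LinearMap.id ∧
    IsGaussian P ε 0 (σ ^ 2 • LinearMap.id) ∧
    IndepFun Z ε P ∧
    ∀ᵐ ω ∂P, X ω = tucker A ν + tucker A (Z ω) + ε ω

/-- The covariance operator `Σ = σ² I + F_A F_A^*` of the model. -/
def covariance (A : (k : Fin r) → Matrix (Fin (n k)) (Fin (m k)) ℝ) (σ : ℝ) :
    Tensor n →ₗ[ℝ] Tensor n :=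
  σ ^ 2 • LinearMap.id + tucker A ∘ₗ LinearMap.adjoint (tucker A)

/-- The sample covariance `S_N = N⁻¹ ∑ i, (x i - μ) ⊗ (x i - μ)` of the data `x`, with the mean
`μ` known. -/
def sampleCovariance {N : ℕ} (μ : Tensor n) (x : Fin N → Tensor n) : Tensor n →ₗ[ℝ] Tensor n :=
  (N : ℝ)⁻¹ • ∑ i, outer (x i - μ) (x i - μ)

end TPCA

end

/-! By rotation-free bookkeeping, each sample is `μ + F_A z + σ ξ` in law, with `z`, `ξ` independent
standard Gaussian tensors. Expanding the quadratic form of the sample covariance gives a noise error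
`ξ ⊗ ξ - I`, a signal error `z ⊗ z - I` and two cross terms `z ⊗ ξ`. The adjoint of `F_A` sends a
rank-one tensor to a rank-one tensor whose factors grow at most by `‖A_k‖`, so these errors are
controlled by their own multilinear norms, weighted by `σ²`, `‖A‖²` and `2σ‖A‖`
(`mlNorm_sampleCovariance_sub_le`).

Each of the three norms is then bounded by a net argument. The form `⟪F u, v⟫` is multilinear in the
factors of `u` and `v`, so moving every factor by `η` changes it by at most `2rη‖F‖_ml`. Only the
factor balls need nets, which makes the entropy a sum of the dimensions rather than their product
(`mlNorm_le_of_nets`, `exists_net_pi`). For a fixed pair in the net, the form is a mean of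
independent subexponential variables: polarization and the Laplace transform of a squared Gaussian
give the bounds `exp (5/3 t²)` for `|t| ≤ 1/5` and `exp (2/3 t²)` for `|t| ≤ 1/2`. Chernoff's bound
and a union bound over the net conclude (`measure_pi_exists_mean_gt_le`). -/

namespace TPCA

variable {r : ℕ} {m n : Fin r → ℕ}

/-! ### Rank-one tensors, the multilinear norm and its discretization. -/

theorem prod_update_apply [DecidableEq (Fin r)] (v : (k : Fin r) → EuclideanSpace ℝ (Fin (n k)))
    (k : Fin r) (w : EuclideanSpace ℝ (Fin (n k))) (i : (k : Fin r) → Fin (n k)) :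
    ∏ j, Function.update v k w j (i j) = w (i k) * ∏ j ∈ Finset.univ.erase k, v j (i j) := by
  rw [← Finset.mul_prod_erase _ _ (Finset.mem_univ k), Function.update_self]
  congr 1
  exact Finset.prod_congr rfl fun j hj => by
    rw [Function.update_of_ne (Finset.ne_of_mem_erase hj)]

/-- The rank-one tensor as a multilinear map of its factors. -/
def rankOneMultilinear (n : Fin r → ℕ) :
    MultilinearMap ℝ (fun k => EuclideanSpace ℝ (Fin (n k))) (Tensor n) where
  toFun := rankOne
  map_update_add' v k x y := by
    ext i
    simp only [rankOne, PiLp.add_apply, prod_update_apply, add_mul]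
  map_update_smul' v k c x := by
    ext i
    simp only [rankOne, PiLp.smul_apply, prod_update_apply, smul_eq_mul, mul_assoc]

theorem rankOneMultilinear_apply (v : (k : Fin r) → EuclideanSpace ℝ (Fin (n k))) :
    rankOneMultilinear n v = rankOne v := rfl

theorem inner_le_mlNorm (F : Tensor m →ₗ[ℝ] Tensor n)
    {u : (k : Fin r) → EuclideanSpace ℝ (Fin (m k))} (hu : ∀ k, ‖u k‖ ≤ 1)
    {v : (k : Fin r) → EuclideanSpace ℝ (Fin (n k))} (hv : ∀ k, ‖v k‖ ≤ 1) :
    inner ℝ (F (rankOne u)) (rankOne v) ≤ mlNorm F :=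
  (isGreatest_mlNorm F).2 ⟨_, ⟨u, hu, rfl⟩, _, ⟨v, hv, rfl⟩, rfl⟩

theorem mlNorm_le {F : Tensor m →ₗ[ℝ] Tensor n} {c : ℝ}
    (h : ∀ (u : (k : Fin r) → EuclideanSpace ℝ (Fin (m k)))
      (v : (k : Fin r) → EuclideanSpace ℝ (Fin (n k))), (∀ k, ‖u k‖ ≤ 1) → (∀ k, ‖v k‖ ≤ 1) →
      inner ℝ (F (rankOne u)) (rankOne v) ≤ c) : mlNorm F ≤ c := by
  obtain ⟨_, ⟨u, hu, rfl⟩, _, ⟨v, hv, rfl⟩, hx⟩ := (isGreatest_mlNorm F).1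
  exact hx ▸ h u v hu hv

/-- A zero factor makes the form vanish. This needs `1 ≤ r`: for `r = 0` the only rank-one tensor is
the empty product and the value can be negative. -/
theorem mlNorm_nonneg (hr : 1 ≤ r) (F : Tensor m →ₗ[ℝ] Tensor n) : 0 ≤ mlNorm F := by
  have h := inner_le_mlNorm F (u := 0) (v := 0) (by simp) (by simp)
  have : rankOne (0 : (k : Fin r) → EuclideanSpace ℝ (Fin (n k))) = 0 :=
    (rankOneMultilinear n).map_coord_zero ⟨0, hr⟩ rfl
  simpa [this] using h

theorem rankOne_eq_prod_smul (v : (k : Fin r) → EuclideanSpace ℝ (Fin (n k))) :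
    rankOne v = (∏ k, ‖v k‖) • rankOne fun k => ‖v k‖⁻¹ • v k := by
  have h := (rankOneMultilinear n).map_smul_univ (fun k => ‖v k‖) fun k => ‖v k‖⁻¹ • v k
  simp only [rankOneMultilinear_apply] at h
  rw [← h]
  congr 1
  ext1 k
  by_cases hk : v k = 0
  · simp [hk]
  · rw [smul_inv_smul₀ (norm_ne_zero_iff.2 hk)]

theorem norm_inv_norm_smul_le_one {E : Type*} [NormedAddCommGroup E] [NormedSpace ℝ E] (x : E) :
    ‖‖x‖⁻¹ • x‖ ≤ 1 := by
  rw [norm_smul, norm_inv, norm_norm]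
  exact inv_mul_le_one

/-- Homogeneity in each factor reduces to factors in the unit ball; flipping the sign of one factor,
available since `1 ≤ r`, gives the absolute value. -/
theorem abs_inner_le_mlNorm (hr : 1 ≤ r) (F : Tensor m →ₗ[ℝ] Tensor n)
    (u : (k : Fin r) → EuclideanSpace ℝ (Fin (m k)))
    (v : (k : Fin r) → EuclideanSpace ℝ (Fin (n k))) :
    |inner ℝ (F (rankOne u)) (rankOne v)| ≤ mlNorm F * ((∏ k, ‖u k‖) * ∏ k, ‖v k‖) := by
  have key : ∀ u : (k : Fin r) → EuclideanSpace ℝ (Fin (m k)),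
      inner ℝ (F (rankOne u)) (rankOne v) ≤ mlNorm F * ((∏ k, ‖u k‖) * ∏ k, ‖v k‖) := by
    intro u
    rw [rankOne_eq_prod_smul u, rankOne_eq_prod_smul v, map_smul, real_inner_smul_left,
      real_inner_smul_right, ← mul_assoc, mul_comm (mlNorm F)]
    exact mul_le_mul_of_nonneg_left
      (inner_le_mlNorm F (fun k => norm_inv_norm_smul_le_one _)
        fun k => norm_inv_norm_smul_le_one _) (by positivity)
  refine abs_le'.2 ⟨key u, ?_⟩
  have h0 : rankOne (Function.update u ⟨0, hr⟩ (-u ⟨0, hr⟩)) = -rankOne u := by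
    have := (rankOneMultilinear m).map_update_neg u ⟨0, hr⟩ (u ⟨0, hr⟩)
    rwa [Function.update_eq_self] at this
  have h1 : ∀ k, ‖Function.update u ⟨0, hr⟩ (-u ⟨0, hr⟩) k‖ = ‖u k‖ := by
    intro k
    by_cases hk : k = ⟨0, hr⟩
    · subst hk; simp
    · simp [hk]
  have := key (Function.update u ⟨0, hr⟩ (-u ⟨0, hr⟩))
  simpa [h0, h1] using this

theorem prod_norm_le_one {ι : Type*} [Fintype ι] {E : ι → Type*}
    [∀ i, NormedAddCommGroup (E i)] {v : (i : ι) → E i} (hv : ∀ i, ‖v i‖ ≤ 1) :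
    ∏ i, ‖v i‖ ≤ 1 :=
  Finset.prod_le_one (fun _ _ => norm_nonneg _) fun i _ => hv i

/-- A bound on `⟪F u, v⟫` over fine enough nets of the factor balls bounds `‖F‖_ml`. -/
theorem mlNorm_le_of_nets (hr : 1 ≤ r) (F : Tensor m →ₗ[ℝ] Tensor n) {η c : ℝ}
    (hη : 2 * r * η ≤ 4 / 9) (hη0 : 0 ≤ η)
    (Nu : Set ((k : Fin r) → EuclideanSpace ℝ (Fin (m k))))
    (Nv : Set ((k : Fin r) → EuclideanSpace ℝ (Fin (n k))))
    (hNu : ∀ u : (k : Fin r) → EuclideanSpace ℝ (Fin (m k)), (∀ k, ‖u k‖ ≤ 1) →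
      ∃ u' ∈ Nu, (∀ k, ‖u' k‖ ≤ 1) ∧ ∀ k, ‖u k - u' k‖ ≤ η)
    (hNv : ∀ v : (k : Fin r) → EuclideanSpace ℝ (Fin (n k)), (∀ k, ‖v k‖ ≤ 1) →
      ∃ v' ∈ Nv, (∀ k, ‖v' k‖ ≤ 1) ∧ ∀ k, ‖v k - v' k‖ ≤ η)
    (h : ∀ u ∈ Nu, ∀ v ∈ Nv, inner ℝ (F (rankOne u)) (rankOne v) ≤ c) :
    mlNorm F ≤ 9 / 5 * c := by
  have hM := mlNorm_nonneg hr F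
  obtain ⟨_, ⟨u, hu, rfl⟩, _, ⟨v, hv, rfl⟩, hx⟩ := (isGreatest_mlNorm F).1
  obtain ⟨u', hu'N, hu', huu⟩ := hNu u hu
  obtain ⟨v', hv'N, hv', hvv⟩ := hNv v hv
  have step : ∀ {d : Fin r → ℕ}
      (f : MultilinearMap ℝ (fun k => EuclideanSpace ℝ (Fin (d k))) ℝ)
      (_ : ∀ x, ‖f x‖ ≤ mlNorm F * ∏ k, ‖x k‖)
      (x y : (k : Fin r) → EuclideanSpace ℝ (Fin (d k))) (_ : ∀ k, ‖x k‖ ≤ 1)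
      (_ : ∀ k, ‖y k‖ ≤ 1) (_ : ∀ k, ‖x k - y k‖ ≤ η), f x - f y ≤ mlNorm F * (r * η) := by
    intro d f hf x y hx hy hxy
    -- The factors are changed one at a time, which costs `η` for each of the `r` factors.
    have h1 := f.norm_image_sub_le_of_bound hM hf x y
    have hx' : ‖x‖ ≤ 1 := (pi_norm_le_iff_of_nonneg zero_le_one).2 hx
    have hy' : ‖y‖ ≤ 1 := (pi_norm_le_iff_of_nonneg zero_le_one).2 hy
    have hxy' : ‖x - y‖ ≤ η := (pi_norm_le_iff_of_nonneg hη0).2 hxy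
    have h2 : max ‖x‖ ‖y‖ ^ (Fintype.card (Fin r) - 1) ≤ 1 :=
      pow_le_one₀ (le_max_of_le_left (norm_nonneg _)) (max_le hx' hy')
    calc f x - f y ≤ ‖f x - f y‖ := le_abs_self _
      _ ≤ _ := h1
      _ ≤ mlNorm F * Fintype.card (Fin r) * 1 * η := by gcongr
      _ = _ := by simp; ring
  have hA := step
    (((innerₗ (Tensor n)).flip (rankOne v) ∘ₗ F).compMultilinearMap (rankOneMultilinear m))
    (fun x => by
      refine (abs_inner_le_mlNorm hr F x v).trans ?_
      exact mul_le_mul_of_nonneg_left (mul_le_of_le_one_right (by positivity)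
        (prod_norm_le_one hv)) hM) u u' hu hu' huu
  have hB := step
    ((innerₗ (Tensor n) (F (rankOne u'))).compMultilinearMap (rankOneMultilinear n))
    (fun x => by
      refine (abs_inner_le_mlNorm hr F u' x).trans ?_
      exact mul_le_mul_of_nonneg_left (mul_le_of_le_one_left (by positivity)
        (prod_norm_le_one hu')) hM) v v' hv hv' hvv
  simp only [LinearMap.compMultilinearMap_apply, LinearMap.comp_apply, LinearMap.flip_apply,
    innerₗ_apply_apply, rankOneMultilinear_apply] at hA hB
  have hC := h u' hu'N v' hv'N
  -- At a maximizing pair, `M ≤ c + 2rηM ≤ c + 4/9 M`, whence `M ≤ 9/5 c`.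
  nlinarith [mul_le_mul_of_nonneg_left hη hM]

/-! ### The Tucker map and the decomposition of the error. -/

/-- The factor matrices act on rank-one tensors factor by factor. -/
theorem adjoint_tucker_rankOne (A : (k : Fin r) → Matrix (Fin (n k)) (Fin (m k)) ℝ)
    (v : (k : Fin r) → EuclideanSpace ℝ (Fin (n k))) :
    LinearMap.adjoint (tucker A) (rankOne v) =
      rankOne fun k => LinearMap.adjoint (Matrix.toEuclideanLin (A k)) (v k) := by
  have h : ∀ k, LinearMap.adjoint (Matrix.toEuclideanLin (A k)) (v k) =
      WithLp.toLp 2 fun j => ∑ i, A k i j * v k i := by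
    intro k
    rw [← Matrix.toEuclideanLin_conjTranspose_eq_adjoint]
    ext j
    simp [Matrix.toLpLin_apply, Matrix.mulVec, dotProduct]
  refine ext_inner_right ℝ fun T => ?_
  rw [LinearMap.adjoint_inner_left]
  simp only [h, rankOne, tucker, LinearMap.coe_mk, AddHom.coe_mk, PiLp.inner_apply,
    RCLike.inner_apply, conj_trivial, Finset.prod_univ_sum, Fintype.piFinset_univ,
    Finset.mul_sum, Finset.sum_mul]
  rw [Finset.sum_comm]
  refine Finset.sum_congr rfl fun j _ => Finset.sum_congr rfl fun i _ => ?_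
  rw [Finset.prod_mul_distrib]
  ring

theorem norm_adjoint_toEuclideanLin_le {a b : ℕ} (M : Matrix (Fin a) (Fin b) ℝ)
    (v : EuclideanSpace ℝ (Fin a)) :
    ‖LinearMap.adjoint (Matrix.toEuclideanLin M) v‖ ≤ specNorm M * ‖v‖ := by
  have : LinearMap.adjoint (Matrix.toEuclideanLin M) v =
      ContinuousLinearMap.adjoint (Matrix.toEuclideanLin M).toContinuousLinearMap v := by
    refine ext_inner_right ℝ fun w => ?_
    rw [LinearMap.adjoint_inner_left, ContinuousLinearMap.adjoint_inner_left]
    rfl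
  rw [this, specNorm, ← LinearIsometryEquiv.norm_map ContinuousLinearMap.adjoint]
  exact ContinuousLinearMap.le_opNorm _ _

theorem prodNorm_nonneg (A : (k : Fin r) → Matrix (Fin (n k)) (Fin (m k)) ℝ) : 0 ≤ prodNorm A :=
  Finset.prod_nonneg fun _ _ => norm_nonneg _

theorem prod_norm_adjoint_le (A : (k : Fin r) → Matrix (Fin (n k)) (Fin (m k)) ℝ)
    {v : (k : Fin r) → EuclideanSpace ℝ (Fin (n k))} (hv : ∀ k, ‖v k‖ ≤ 1) :
    ∏ k, ‖LinearMap.adjoint (Matrix.toEuclideanLin (A k)) (v k)‖ ≤ prodNorm A :=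
  Finset.prod_le_prod (fun _ _ => norm_nonneg _) fun k _ =>
    (norm_adjoint_toEuclideanLin_le _ _).trans (mul_le_of_le_one_right (norm_nonneg _) (hv k))

/-- The empirical cross covariance `N⁻¹ ∑ i, x i ⊗ y i`. -/
noncomputable def crossCovariance {N : ℕ} (x : Fin N → Tensor n) (y : Fin N → Tensor m) :
    Tensor m →ₗ[ℝ] Tensor n :=
  (N : ℝ)⁻¹ • ∑ i, outer (x i) (y i)

theorem inner_crossCovariance {N : ℕ} (x : Fin N → Tensor n) (y : Fin N → Tensor m)
    (u : Tensor m) (v : Tensor n) :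
    inner ℝ (crossCovariance x y u) v =
      (N : ℝ)⁻¹ * ∑ i, inner ℝ (y i) u * inner ℝ (x i) v := by
  simp [crossCovariance, outer, sum_inner, real_inner_smul_left]

theorem inner_crossCovariance_sub_id {N : ℕ} (hN : 1 ≤ N) (x : Fin N → Tensor n)
    (u v : Tensor n) :
    inner ℝ ((crossCovariance x x - LinearMap.id : Tensor n →ₗ[ℝ] Tensor n) u) v =
      (N : ℝ)⁻¹ * ∑ i, (inner ℝ (x i) u * inner ℝ (x i) v - inner ℝ u v) := by
  have : (N : ℝ) ≠ 0 := by positivity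
  rw [LinearMap.sub_apply, inner_sub_left, inner_crossCovariance, Finset.sum_sub_distrib]
  simp
  field_simp

/-- The error of the sample covariance splits into noise, signal and cross terms. -/
theorem mlNorm_sampleCovariance_sub_le {N : ℕ} (hr : 1 ≤ r)
    (A : (k : Fin r) → Matrix (Fin (n k)) (Fin (m k)) ℝ) {σ : ℝ} (hσ : 0 ≤ σ) (μ : Tensor n)
    (z : Fin N → Tensor m) (ξ : Fin N → Tensor n) :
    mlNorm (sampleCovariance μ (fun i => μ + tucker A (z i) + σ • ξ i) - covariance A σ) ≤
      σ ^ 2 * mlNorm (crossCovariance ξ ξ - LinearMap.id) +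
      prodNorm A ^ 2 * mlNorm (crossCovariance z z - LinearMap.id) +
      2 * σ * prodNorm A * mlNorm (crossCovariance z ξ) := by
  refine mlNorm_le fun u v hu hv => ?_
  set u' := fun k => LinearMap.adjoint (Matrix.toEuclideanLin (A k)) (u k)
  set v' := fun k => LinearMap.adjoint (Matrix.toEuclideanLin (A k)) (v k)
  have hu' : ∏ k, ‖u' k‖ ≤ prodNorm A := prod_norm_adjoint_le A hu
  have hv' : ∏ k, ‖v' k‖ ≤ prodNorm A := prod_norm_adjoint_le A hv
  have hA := prodNorm_nonneg A
  -- The matrices are moved onto the test vectors, so all remaining operators involve standard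
  -- Gaussian data only; the cross operator occurs once with `u, v'` and once with `v, u'`.
  have e : inner ℝ ((sampleCovariance μ (fun i => μ + tucker A (z i) + σ • ξ i) -
      covariance A σ) (rankOne u)) (rankOne v) =
      σ ^ 2 * inner ℝ ((crossCovariance ξ ξ - LinearMap.id : Tensor n →ₗ[ℝ] Tensor n) (rankOne u)) (rankOne v) +
      inner ℝ ((crossCovariance z z - LinearMap.id : Tensor m →ₗ[ℝ] Tensor m) (rankOne u')) (rankOne v') +
      σ * (inner ℝ (crossCovariance z ξ (rankOne u)) (rankOne v') +
        inner ℝ (crossCovariance z ξ (rankOne v)) (rankOne u')) := by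
    have hs : sampleCovariance μ (fun i => μ + tucker A (z i) + σ • ξ i) =
        crossCovariance (fun i => tucker A (z i) + σ • ξ i)
          fun i => tucker A (z i) + σ • ξ i := by
      simp [sampleCovariance, crossCovariance, add_assoc]
    have hc : inner ℝ (covariance A σ (rankOne u)) (rankOne v) =
        σ ^ 2 * inner ℝ (rankOne u) (rankOne v) + inner ℝ (rankOne u') (rankOne v') := by
      rw [covariance, LinearMap.add_apply, inner_add_left, LinearMap.comp_apply,
        ← LinearMap.adjoint_inner_right (tucker A), adjoint_tucker_rankOne,
        adjoint_tucker_rankOne]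
      simp [real_inner_smul_left, u', v']
    have hz : ∀ i w, inner ℝ (tucker A (z i)) (rankOne w) =
        inner ℝ (z i) (rankOne fun k => LinearMap.adjoint (Matrix.toEuclideanLin (A k)) (w k)) :=
      fun i w => by rw [← adjoint_tucker_rankOne, LinearMap.adjoint_inner_right]
    simp only [LinearMap.sub_apply, inner_sub_left, hs, hc, inner_crossCovariance, inner_add_left,
      real_inner_smul_left, hz, LinearMap.id_apply]
    have hsum : ∑ i, ((inner ℝ (z i) (rankOne u') + σ * inner ℝ (ξ i) (rankOne u)) *
        (inner ℝ (z i) (rankOne v') + σ * inner ℝ (ξ i) (rankOne v))) =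
        σ ^ 2 * ∑ i, inner ℝ (ξ i) (rankOne u) * inner ℝ (ξ i) (rankOne v) +
        ∑ i, inner ℝ (z i) (rankOne u') * inner ℝ (z i) (rankOne v') +
        σ * (∑ i, inner ℝ (ξ i) (rankOne u) * inner ℝ (z i) (rankOne v') +
          ∑ i, inner ℝ (ξ i) (rankOne v) * inner ℝ (z i) (rankOne u')) := by
      simp only [Finset.mul_sum, ← Finset.sum_add_distrib]
      exact Finset.sum_congr rfl fun i _ => by ring
    rw [hsum]
    ring
  have h1 := inner_le_mlNorm (crossCovariance ξ ξ - LinearMap.id) hu hv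
  have h2 := (le_abs_self _).trans
    (abs_inner_le_mlNorm hr (crossCovariance z z - LinearMap.id) u' v')
  have h3 := (le_abs_self _).trans (abs_inner_le_mlNorm hr (crossCovariance z ξ) u v')
  have h4 := (le_abs_self _).trans (abs_inner_le_mlNorm hr (crossCovariance z ξ) v u')
  have m2 := mlNorm_nonneg hr (crossCovariance z z - LinearMap.id)
  have m3 := mlNorm_nonneg hr (crossCovariance z ξ)
  have hpu := prod_norm_le_one hu
  have hpv := prod_norm_le_one hv
  have h2' : (∏ k, ‖u' k‖) * ∏ k, ‖v' k‖ ≤ prodNorm A ^ 2 := by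
    rw [sq]; gcongr
  have h3' : (∏ k, ‖u k‖) * ∏ k, ‖v' k‖ ≤ prodNorm A :=
    (mul_le_of_le_one_left (by positivity) hpu).trans hv'
  have h4' : (∏ k, ‖v k‖) * ∏ k, ‖u' k‖ ≤ prodNorm A :=
    (mul_le_of_le_one_left (by positivity) hpv).trans hu'
  rw [e]
  have g1 := mul_le_mul_of_nonneg_left h1 (sq_nonneg σ)
  have g2 := h2.trans (mul_le_mul_of_nonneg_left h2' m2)
  have g3 := h3.trans (mul_le_mul_of_nonneg_left h3' m3)
  have g4 := h4.trans (mul_le_mul_of_nonneg_left h4' m3)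
  have g5 := mul_le_mul_of_nonneg_left (add_le_add g3 g4) hσ
  nlinarith

/-! ### Nets of the unit balls and of their product. -/

/-- The volume bound on the size of a separated subset of the unit ball. -/
theorem card_le_of_separated {d : ℕ} {ε : ℝ} (hε : 0 < ε)
    (s : Finset (EuclideanSpace ℝ (Fin d))) (hs : ∀ x ∈ s, ‖x‖ ≤ 1)
    (hsep : ∀ x ∈ s, ∀ y ∈ s, x ≠ y → ε ≤ ‖x - y‖) : (s.card : ℝ) ≤ (1 + 2 / ε) ^ d := by
  set V : Measure (EuclideanSpace ℝ (Fin d)) := volume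
  have hd : (s : Set (EuclideanSpace ℝ (Fin d))).PairwiseDisjoint
      fun x => Metric.ball x (ε / 2) := by
    intro x hx y hy hxy
    refine Metric.ball_disjoint_ball ?_
    rw [dist_eq_norm]
    linarith [hsep x hx y hy hxy]
  have hsub : (⋃ x ∈ s, Metric.ball x (ε / 2)) ⊆ Metric.ball 0 (1 + ε / 2) := by
    refine Set.iUnion₂_subset fun x hx => Metric.ball_subset_ball' ?_
    rw [dist_zero_right]
    linarith [hs x hx]
  have h := measure_mono (μ := V) hsub
  rw [measure_biUnion_finset hd fun x _ => measurableSet_ball] at h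
  simp only [V, Measure.addHaar_ball_of_pos _ _ (half_pos hε),
    Measure.addHaar_ball_of_pos _ _ (show 0 < 1 + ε / 2 by positivity), Finset.sum_const,
    nsmul_eq_mul, finrank_euclideanSpace, Fintype.card_fin, ← mul_assoc] at h
  have h0 : volume (Metric.ball (0 : EuclideanSpace ℝ (Fin d)) 1) ≠ 0 :=
    (Metric.measure_ball_pos _ _ one_pos).ne'
  have h1 : volume (Metric.ball (0 : EuclideanSpace ℝ (Fin d)) 1) ≠ ⊤ := measure_ball_lt_top.ne
  rw [ENNReal.mul_le_mul_iff_left h0 h1, ← ENNReal.ofReal_natCast,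
    ← ENNReal.ofReal_mul (by positivity), ENNReal.ofReal_le_ofReal_iff (by positivity)] at h
  have e : 1 + 2 / ε = (1 + ε / 2) / (ε / 2) := by field_simp; ring
  rw [e, div_pow, le_div_iff₀ (by positivity)]
  exact h

/-- The unit ball of `ℝᵈ` has an `ε`-net of cardinality at most `(1 + 2 / ε) ^ d`. -/
theorem exists_net_ball (d : ℕ) {ε : ℝ} (hε : 0 < ε) :
    ∃ s : Finset (EuclideanSpace ℝ (Fin d)), (∀ x ∈ s, ‖x‖ ≤ 1) ∧
      (s.card : ℝ) ≤ (1 + 2 / ε) ^ d ∧ ∀ x, ‖x‖ ≤ 1 → ∃ y ∈ s, ‖x - y‖ ≤ ε := by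
  classical
  let S : Set (Finset (EuclideanSpace ℝ (Fin d))) :=
    {s | (∀ x ∈ s, ‖x‖ ≤ 1) ∧ ∀ x ∈ s, ∀ y ∈ s, x ≠ y → ε ≤ ‖x - y‖}
  have hb : ∀ s ∈ S, s.card ≤ ⌊(1 + 2 / ε) ^ d⌋₊ := fun s hs =>
    Nat.le_floor (card_le_of_separated hε s hs.1 hs.2)
  have hbdd : BddAbove (Finset.card '' S) := ⟨_, by rintro _ ⟨s, hs, rfl⟩; exact hb s hs⟩
  -- A separated set of largest cardinality is a net, since a point far from all of it could be
  -- added.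
  obtain ⟨s, hs, hmax⟩ := Nat.sSup_mem (s := Finset.card '' S)
    ⟨_, ∅, ⟨by simp, by simp⟩, rfl⟩ hbdd
  refine ⟨s, hs.1, card_le_of_separated hε s hs.1 hs.2, fun x hx => ?_⟩
  by_contra! hfar
  have hxs : x ∉ s := fun h => by
    have := hfar x h
    simp at this
    linarith
  have hins : insert x s ∈ S := by
    refine ⟨fun y hy => ?_, fun y hy z hz hyz => ?_⟩
    · rcases Finset.mem_insert.1 hy with rfl | hy
      · exact hx
      · exact hs.1 y hy
    · rcases Finset.mem_insert.1 hy with rfl | hy' <;>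
        rcases Finset.mem_insert.1 hz with rfl | hz'
      · exact absurd rfl hyz
      · exact (hfar z hz').le
      · rw [norm_sub_rev]; exact (hfar y hy').le
      · exact hs.2 y hy' z hz' hyz
  have := le_csSup hbdd ⟨_, hins, rfl⟩
  rw [← hmax, Finset.card_insert_of_notMem hxs] at this
  omega

/-- A product of nets of the factor balls, of cardinality at most `(10 r) ^ (n₁ + ⋯ + nᵣ)`. -/
theorem exists_net_pi (hr : 1 ≤ r) (n : Fin r → ℕ) :
    ∃ s : Finset ((k : Fin r) → EuclideanSpace ℝ (Fin (n k))), (∀ u ∈ s, ∀ k, ‖u k‖ ≤ 1) ∧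
      (s.card : ℝ) ≤ Real.exp (Real.log (10 * r) * ∑ k, (n k : ℝ)) ∧
      ∀ u : (k : Fin r) → EuclideanSpace ℝ (Fin (n k)), (∀ k, ‖u k‖ ≤ 1) →
        ∃ u' ∈ s, (∀ k, ‖u' k‖ ≤ 1) ∧ ∀ k, ‖u k - u' k‖ ≤ 2 / (10 * r - 1) := by
  classical
  have hr' : (1 : ℝ) ≤ r := by exact_mod_cast hr
  have hε : 0 < 2 / (10 * (r : ℝ) - 1) := div_pos two_pos (by linarith)
  choose s hs1 hsc hsn using fun k => exists_net_ball (n k) hε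
  refine ⟨Fintype.piFinset s, fun u hu k => hs1 k _ (Fintype.mem_piFinset.1 hu k), ?_,
    fun u hu => ?_⟩
  -- The radius `2 / (10 r - 1)` is chosen to make the volume bound exactly `(10 r) ^ n k`.
  · have e : 1 + 2 / (2 / (10 * (r : ℝ) - 1)) = 10 * r := by
      have : 10 * (r : ℝ) - 1 ≠ 0 := by linarith
      field_simp
      ring
    rw [Fintype.card_piFinset, Nat.cast_prod, Finset.mul_sum, Real.exp_sum]
    refine Finset.prod_le_prod (fun _ _ => by positivity) fun k _ => (hsc k).trans ?_
    rw [e, mul_comm (Real.log _), Real.exp_nat_mul, Real.exp_log (by linarith)]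
  · choose u' hu' hd using fun k => hsn k (u k) (hu k)
    exact ⟨u', Fintype.mem_piFinset.2 hu', fun k => hs1 k _ (hu' k), hd⟩

theorem two_mul_mul_net_radius_le (hr : 1 ≤ r) : 2 * (r : ℝ) * (2 / (10 * r - 1)) ≤ 4 / 9 := by
  have hr' : (1 : ℝ) ≤ r := by exact_mod_cast hr
  rw [← mul_div_assoc, div_le_div_iff₀ (by linarith) (by norm_num)]
  linarith

/-! ### Exponential moments of Gaussian products. -/

theorem lintegral_exp_mul_sq_gaussianReal_one {c : ℝ} (hc : 2 * c < 1) :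
    ∫⁻ y, ENNReal.ofReal (Real.exp (c * y ^ 2)) ∂(gaussianReal 0 1) =
      ENNReal.ofReal (Real.sqrt (1 - 2 * c))⁻¹ := by
  have hb : 0 < 1 / 2 - c := by linarith
  rw [gaussianReal_of_var_ne_zero _ one_ne_zero,
    lintegral_withDensity_eq_lintegral_mul _ (measurable_gaussianPDF 0 1) (by fun_prop)]
  have e : ∀ y : ℝ, (gaussianPDF 0 1 * fun y => ENNReal.ofReal (Real.exp (c * y ^ 2))) y =
      ENNReal.ofReal ((Real.sqrt (2 * Real.pi))⁻¹ * Real.exp (-(1 / 2 - c) * y ^ 2)) := by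
    intro y
    rw [Pi.mul_apply, gaussianPDF, ← ENNReal.ofReal_mul (gaussianPDFReal_nonneg _ _ _),
      gaussianPDFReal_def]
    simp only [NNReal.coe_one, mul_one, sub_zero]
    rw [mul_assoc, ← Real.exp_add]
    congr 3
    ring
  simp_rw [e]
  rw [← ofReal_integral_eq_lintegral_ofReal ((integrable_exp_neg_mul_sq hb).const_mul _)
    (ae_of_all _ fun y => by positivity), integral_const_mul, integral_gaussian]
  congr 1
  rw [← Real.sqrt_inv, ← Real.sqrt_inv, ← Real.sqrt_mul (by positivity)]
  congr 1
  have : (1 : ℝ) - 2 * c ≠ 0 := by linarith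
  field_simp

theorem lintegral_exp_mul_sq_gaussianReal {c v : ℝ} (hv : 0 ≤ v) (hc : 2 * (c * v) < 1) :
    ∫⁻ y, ENNReal.ofReal (Real.exp (c * y ^ 2)) ∂(gaussianReal 0 v.toNNReal) =
      ENNReal.ofReal (Real.sqrt (1 - 2 * (c * v)))⁻¹ := by
  have h : gaussianReal 0 v.toNNReal = (gaussianReal 0 1).map (Real.sqrt v * ·) := by
    rw [gaussianReal_map_const_mul]
    congr 1
    · simp
    · ext; simp [hv]
  rw [h, lintegral_map (by fun_prop) (by fun_prop), ← lintegral_exp_mul_sq_gaussianReal_one hc]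
  simp only [mul_pow, Real.sq_sqrt hv, mul_assoc]

theorem lintegral_exp_mul_gaussianReal (v : NNReal) (t : ℝ) :
    ∫⁻ y, ENNReal.ofReal (Real.exp (t * y)) ∂(gaussianReal 0 v) =
      ENNReal.ofReal (Real.exp (v * t ^ 2 / 2)) := by
  rw [← ofReal_integral_eq_lintegral_ofReal (integrable_exp_mul_gaussianReal t)
    (ae_of_all _ fun y => by positivity)]
  have := mgf_gaussianReal (p := gaussianReal 0 v) (X := id) (μ := 0) (v := v) (by simp) t
  rw [mgf] at this
  simp only [id_eq, zero_mul, zero_add] at this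
  rw [this]

section StdGaussian

variable {E : Type*} [NormedAddCommGroup E] [InnerProductSpace ℝ E] [FiniteDimensional ℝ E]
  [MeasurableSpace E] [BorelSpace E]

theorem map_inner_stdGaussian (w : E) :
    (stdGaussian E).map (fun x => inner ℝ x w) = gaussianReal 0 (‖w‖ ^ 2).toNNReal := by
  have h := IsGaussian.map_eq_gaussianReal (μ := stdGaussian E) (innerSL ℝ w)
  rw [variance_dual_stdGaussian, integral_strongDual_stdGaussian, innerSL_apply_norm] at h
  rw [← h]
  congr 1
  ext x
  simp [real_inner_comm]

theorem lintegral_inner_stdGaussian (w : E) {g : ℝ → ENNReal} (hg : Measurable g) :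
    ∫⁻ x, g (inner ℝ x w) ∂(stdGaussian E) =
      ∫⁻ y, g y ∂(gaussianReal 0 (‖w‖ ^ 2).toNNReal) := by
  rw [← map_inner_stdGaussian, lintegral_map hg (by fun_prop)]

/-- For `x ≥ 0`, `(1 - 2x)⁻¹ ≤ 1 + y + y²/2 ≤ exp y` with `y = 2x + 10/3 x²`; for `x ≤ 0`, the
Padé-type bound `2s/(s+2) ≤ log (1+s)` with `s = -2x` is enough. -/
theorem inv_sqrt_one_sub_le {x : ℝ} (hx : |x| ≤ 1 / 5) :
    (Real.sqrt (1 - 2 * x))⁻¹ ≤ Real.exp (x + 5 / 3 * x ^ 2) := by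
  obtain ⟨hx1, hx2⟩ := abs_le.1 hx
  have hpos : 0 < 1 - 2 * x := by linarith
  have hlog : -(2 * x + 10 / 3 * x ^ 2) ≤ Real.log (1 - 2 * x) := by
    rcases le_total 0 x with h | h
    · rw [Real.le_log_iff_exp_le hpos, Real.exp_neg]
      refine inv_le_of_inv_le₀ hpos (le_trans ?_ (Real.quadratic_le_exp_of_nonneg (by positivity)))
      rw [inv_le_iff_one_le_mul₀ hpos]
      have h3 : 0 ≤ x ^ 2 * (1 / 5 - x) := by have := sub_nonneg.2 hx2; positivity
      have h4 : 0 ≤ x ^ 3 * (1 / 5 - x) := by have := sub_nonneg.2 hx2; positivity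
      have h5 : 0 ≤ x ^ 4 * (1 / 5 - x) := by have := sub_nonneg.2 hx2; positivity
      nlinarith [sq_nonneg x]
    · have := Real.le_log_one_add_of_nonneg (x := -2 * x) (by linarith)
      rw [show 1 + -2 * x = 1 - 2 * x by ring] at this
      refine le_trans ?_ this
      rw [le_div_iff₀ (by linarith)]
      nlinarith [mul_nonneg (sq_nonneg x) (neg_nonneg.2 h), sq_nonneg x]
  rw [← Real.exp_log (Real.sqrt_pos.2 hpos), ← Real.exp_neg, Real.exp_le_exp, Real.log_sqrt hpos.le]
  linarith

theorem inv_sqrt_one_sub_le_exp {y : ℝ} (hy : 0 ≤ y) (hy' : y ≤ 1 / 4) :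
    (Real.sqrt (1 - y))⁻¹ ≤ Real.exp (2 / 3 * y) := by
  have hpos : 0 < 1 - y := by linarith
  have hlog : -(4 / 3 * y) ≤ Real.log (1 - y) := by
    refine le_trans ?_ (Real.one_sub_inv_le_log_of_pos hpos)
    rw [neg_le_sub_iff_le_add, inv_le_iff_one_le_mul₀ hpos]
    nlinarith
  rw [← Real.exp_log (Real.sqrt_pos.2 hpos), ← Real.exp_neg, Real.exp_le_exp, Real.log_sqrt hpos.le]
  linarith

theorem lintegral_exp_sq_inner_stdGaussian_le {w : E} (hw : w ≠ 0) {t : ℝ} (ht : |t| ≤ 1 / 5) :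
    ∫⁻ x, ENNReal.ofReal (Real.exp (t * (inner ℝ x w ^ 2 / ‖w‖ ^ 2 - 1))) ∂(stdGaussian E) ≤
      ENNReal.ofReal (Real.exp (5 / 3 * t ^ 2)) := by
  have hw' : ‖w‖ ^ 2 ≠ 0 := by simpa using hw
  have h1 : t / ‖w‖ ^ 2 * ‖w‖ ^ 2 = t := div_mul_cancel₀ _ hw'
  have e : ∀ x : E, ENNReal.ofReal (Real.exp (t * (inner ℝ x w ^ 2 / ‖w‖ ^ 2 - 1))) =
      ENNReal.ofReal (Real.exp (-t)) *
        ENNReal.ofReal (Real.exp (t / ‖w‖ ^ 2 * inner ℝ x w ^ 2)) := by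
    intro x
    rw [← ENNReal.ofReal_mul (by positivity), ← Real.exp_add]
    congr 2
    ring
  simp_rw [e]
  rw [lintegral_const_mul _ (by fun_prop),
    lintegral_inner_stdGaussian w (g := fun y => ENNReal.ofReal (Real.exp (t / ‖w‖ ^ 2 * y ^ 2)))
      (by fun_prop),
    lintegral_exp_mul_sq_gaussianReal (by positivity)
      (by rw [h1]; linarith [(abs_le.1 ht).2]), h1, ← ENNReal.ofReal_mul (by positivity)]
  refine ENNReal.ofReal_le_ofReal ?_
  calc Real.exp (-t) * (Real.sqrt (1 - 2 * t))⁻¹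
      ≤ Real.exp (-t) * Real.exp (t + 5 / 3 * t ^ 2) := by
        gcongr; exact inv_sqrt_one_sub_le ht
    _ = _ := by rw [← Real.exp_add]; congr 1; ring

/-- Convexity of `exp`, the leftover weight `1 - p - q` being placed at `0`. -/
theorem exp_weighted_le {p q x y : ℝ} (hp : 0 ≤ p) (hq : 0 ≤ q) (hpq : p + q ≤ 1) :
    Real.exp (p * x + q * y) ≤ p * Real.exp x + q * Real.exp y + (1 - p - q) := by
  have h := Real.geom_mean_le_arith_mean3_weighted hp hq (by linarith : 0 ≤ 1 - p - q)
    (Real.exp_pos x).le (Real.exp_pos y).le zero_le_one (by ring)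
  rw [← Real.exp_mul, ← Real.exp_mul, Real.one_rpow, mul_one, mul_one, ← Real.exp_add] at h
  simpa [mul_comm] using h

/-- The centred product of two linear functionals of a standard Gaussian vector is
subexponential. -/
theorem lintegral_exp_inner_mul_inner_le {u v : E} (hu : ‖u‖ ≤ 1) (hv : ‖v‖ ≤ 1) {t : ℝ}
    (ht : |t| ≤ 1 / 5) :
    ∫⁻ x, ENNReal.ofReal (Real.exp (t * (inner ℝ x u * inner ℝ x v - inner ℝ u v)))
      ∂(stdGaussian E) ≤ ENNReal.ofReal (Real.exp (5 / 3 * t ^ 2)) := by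
  set B := ENNReal.ofReal (Real.exp (5 / 3 * t ^ 2))
  set f : E → ℝ → E → ENNReal := fun w s x =>
    ENNReal.ofReal (Real.exp (s * (inner ℝ x w ^ 2 / ‖w‖ ^ 2 - 1)))
  have hf : ∀ w s, Measurable (f w s) := fun w s => by fun_prop
  -- The weight `‖w‖² / 4` vanishes when `w = 0`, so the convention for division by zero is
  -- harmless.
  have key : ∀ w : E, ∀ s : ℝ, |s| ≤ 1 / 5 → s ^ 2 = t ^ 2 →
      ENNReal.ofReal (‖w‖ ^ 2 / 4) * ∫⁻ x, f w s x ∂(stdGaussian E) ≤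
        ENNReal.ofReal (‖w‖ ^ 2 / 4) * B := by
    intro w s hs hst
    by_cases hw : w = 0
    · simp [hw]
    · gcongr
      exact (lintegral_exp_sq_inner_stdGaussian_le hw hs).trans_eq (by rw [hst])
  have hsum : ‖u + v‖ ^ 2 / 4 + ‖u - v‖ ^ 2 / 4 ≤ 1 := by
    have := parallelogram_law_with_norm ℝ u v
    nlinarith [norm_nonneg u, norm_nonneg v]
  have hsq : ∀ w x : E, ‖w‖ ^ 2 * (inner ℝ x w ^ 2 / ‖w‖ ^ 2) = inner ℝ x w ^ 2 := by
    intro w x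
    by_cases hw : w = 0
    · simp [hw]
    · have hw' : ‖w‖ ^ 2 ≠ 0 := by simpa using hw
      field_simp
  -- Polarization writes the centred product as a difference of centred normalized squares along `u
  -- + v` and `u - v`, with weights summing to `(‖u‖² + ‖v‖²) / 2 ≤ 1`. Convexity then separates the
  -- squares without using their independence.
  have hpt : ∀ x, ENNReal.ofReal (Real.exp (t * (inner ℝ x u * inner ℝ x v - inner ℝ u v))) ≤
      ENNReal.ofReal (‖u + v‖ ^ 2 / 4) * f (u + v) t x +
        ENNReal.ofReal (‖u - v‖ ^ 2 / 4) * f (u - v) (-t) x +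
        ENNReal.ofReal (1 - ‖u + v‖ ^ 2 / 4 - ‖u - v‖ ^ 2 / 4) := by
    intro x
    simp only [f]
    rw [← ENNReal.ofReal_mul (by positivity), ← ENNReal.ofReal_mul (by positivity),
      ← ENNReal.ofReal_add (by positivity) (by positivity),
      ← ENNReal.ofReal_add (by positivity) (by linarith)]
    refine ENNReal.ofReal_le_ofReal (le_trans (le_of_eq ?_)
      (exp_weighted_le (by positivity) (by positivity) hsum))
    congr 1
    have h1 := hsq (u + v) x
    have h2 := hsq (u - v) x
    have h3 := norm_add_sq_real u v
    have h4 := norm_sub_sq_real u v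
    rw [inner_add_right] at h1 ⊢
    rw [inner_sub_right] at h2 ⊢
    linear_combination (-t / 4) * h1 + (t / 4) * h2 + (t / 4) * h3 - (t / 4) * h4
  refine (lintegral_mono hpt).trans ?_
  rw [lintegral_add_right _ measurable_const,
    lintegral_add_right _ ((hf _ _).const_mul _), lintegral_const_mul _ (hf _ _),
    lintegral_const_mul _ (hf _ _), lintegral_const, measure_univ, mul_one]
  have hB : 1 ≤ B := by
    rw [← ENNReal.ofReal_one]
    exact ENNReal.ofReal_le_ofReal (Real.one_le_exp (by positivity))
  calc _ ≤ ENNReal.ofReal (‖u + v‖ ^ 2 / 4) * B + ENNReal.ofReal (‖u - v‖ ^ 2 / 4) * B +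
      ENNReal.ofReal (1 - ‖u + v‖ ^ 2 / 4 - ‖u - v‖ ^ 2 / 4) * B := by
        refine add_le_add (add_le_add (key _ _ ht rfl) (key _ _ (by rwa [abs_neg]) (by ring))) ?_
        exact le_mul_of_one_le_right' hB
    _ = B := by
        rw [← add_mul, ← add_mul, ← ENNReal.ofReal_add (by positivity) (by positivity),
          ← ENNReal.ofReal_add (by positivity) (by linarith)]
        simp

/-- The product of linear functionals of independent standard Gaussian vectors is
subexponential. -/
theorem lintegral_exp_inner_mul_inner_prod_le {F : Type*} [NormedAddCommGroup F]
    [InnerProductSpace ℝ F] [FiniteDimensional ℝ F] [MeasurableSpace F] [BorelSpace F]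
    {u : E} {v : F} (hu : ‖u‖ ≤ 1) (hv : ‖v‖ ≤ 1) {t : ℝ} (ht : |t| ≤ 1 / 2) :
    ∫⁻ x, ENNReal.ofReal (Real.exp (t * (inner ℝ x.2 v * inner ℝ x.1 u)))
      ∂((stdGaussian E).prod (stdGaussian F)) ≤ ENNReal.ofReal (Real.exp (2 / 3 * t ^ 2)) := by
  -- Integrating out the second vector leaves the exponential of a squared Gaussian in the first.
  rw [lintegral_prod _ (Measurable.aemeasurable (by fun_prop))]
  have e : ∀ z : E, ∫⁻ x, ENNReal.ofReal (Real.exp (t * (inner ℝ x v * inner ℝ z u)))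
      ∂(stdGaussian F) =
      ENNReal.ofReal (Real.exp (‖v‖ ^ 2 * t ^ 2 / 2 * inner ℝ z u ^ 2)) := by
    intro z
    rw [lintegral_inner_stdGaussian v
      (g := fun y => ENNReal.ofReal (Real.exp (t * (y * inner ℝ z u)))) (by fun_prop)]
    have := lintegral_exp_mul_gaussianReal (‖v‖ ^ 2).toNNReal (t * inner ℝ z u)
    rw [Real.coe_toNNReal _ (by positivity)] at this
    convert this using 5 <;> ring
  simp only [e]
  have hx : 2 * (‖v‖ ^ 2 * t ^ 2 / 2 * ‖u‖ ^ 2) ≤ t ^ 2 := by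
    have h1 : ‖v‖ ^ 2 ≤ 1 := pow_le_one₀ (norm_nonneg _) hv
    have h2 : ‖u‖ ^ 2 ≤ 1 := pow_le_one₀ (norm_nonneg _) hu
    calc _ = t ^ 2 * (‖v‖ ^ 2 * ‖u‖ ^ 2) := by ring
      _ ≤ t ^ 2 * (1 * 1) := by gcongr
      _ = t ^ 2 := by ring
  have ht2 : t ^ 2 ≤ 1 / 4 := by
    rw [← sq_abs]
    nlinarith [abs_nonneg t]
  rw [lintegral_inner_stdGaussian u
    (g := fun y => ENNReal.ofReal (Real.exp (‖v‖ ^ 2 * t ^ 2 / 2 * y ^ 2))) (by fun_prop),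
    lintegral_exp_mul_sq_gaussianReal (by positivity) (by linarith)]
  refine ENNReal.ofReal_le_ofReal
    ((inv_sqrt_one_sub_le_exp (by positivity) (hx.trans ht2)).trans ?_)
  gcongr

end StdGaussian

/-! ### Chernoff's bound and the union bound. -/

/-- Chernoff's bound for the mean of independent copies. -/
theorem measure_pi_mean_gt_le {S : Type*} [MeasurableSpace S] (κ : Measure S)
    [IsProbabilityMeasure κ] {N : ℕ} (hN : 1 ≤ N) {f : S → ℝ} (hf : Measurable f) {t c s : ℝ}
    (ht : 0 ≤ t)
    (hc : ∫⁻ x, ENNReal.ofReal (Real.exp (t * f x)) ∂κ ≤ ENNReal.ofReal (Real.exp c)) :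
    Measure.pi (fun _ : Fin N => κ) {x | s < (N : ℝ)⁻¹ * ∑ i, f (x i)} ≤
      ENNReal.ofReal (Real.exp (-(N * (t * s - c)))) := by
  set Q := Measure.pi (fun _ : Fin N => κ)
  have hN' : (0 : ℝ) < N := by positivity
  have hsub : {x : Fin N → S | s < (N : ℝ)⁻¹ * ∑ i, f (x i)} ⊆
      {x | ENNReal.ofReal (Real.exp (N * (t * s))) ≤
        ∏ i, ENNReal.ofReal (Real.exp (t * f (x i)))} := by
    intro x hx
    simp only [Set.mem_ofPred_eq] at hx ⊢
    rw [← ENNReal.ofReal_prod_of_nonneg fun _ _ => (Real.exp_pos _).le, ← Real.exp_sum,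
      ← Finset.mul_sum]
    refine ENNReal.ofReal_le_ofReal (Real.exp_le_exp.2 ?_)
    rw [lt_inv_mul_iff₀ hN'] at hx
    nlinarith [mul_le_mul_of_nonneg_left hx.le ht]
  have hm : Measurable fun x => ENNReal.ofReal (Real.exp (t * f x)) := by fun_prop
  have hprod : ∫⁻ x, ∏ i, ENNReal.ofReal (Real.exp (t * f (x i))) ∂Q =
      ∏ _i : Fin N, ∫⁻ x, ENNReal.ofReal (Real.exp (t * f x)) ∂κ := by
    have hind : iIndepFun (fun (i : Fin N) (x : Fin N → S) =>
        ENNReal.ofReal (Real.exp (t * f (x i)))) Q :=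
      iIndepFun_pi (X := fun (_ : Fin N) x => ENNReal.ofReal (Real.exp (t * f x)))
        fun _ => hm.aemeasurable
    rw [lintegral_prod_eq_prod_lintegral_of_indepFun Finset.univ _ hind
      fun i => hm.comp (measurable_pi_apply i)]
    refine Finset.prod_congr rfl fun i _ => ?_
    exact (measurePreserving_eval (fun _ : Fin N => κ) i).lintegral_comp hm
  refine (measure_mono hsub).trans ((meas_ge_le_lintegral_div
    (Finset.measurable_prod _ fun i _ => hm.comp (measurable_pi_apply i)).aemeasurable
    (by simp [Real.exp_pos]) ENNReal.ofReal_ne_top).trans ?_)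
  simp only [Function.comp_def]
  rw [hprod, Finset.prod_const, Finset.card_univ, Fintype.card_fin]
  calc _ ≤ ENNReal.ofReal (Real.exp c) ^ N / ENNReal.ofReal (Real.exp (N * (t * s))) := by
        gcongr
    _ = _ := by
        rw [← ENNReal.ofReal_pow (Real.exp_pos _).le, ← Real.exp_nat_mul,
          ← ENNReal.ofReal_div_of_pos (Real.exp_pos _), ← Real.exp_sub]
        congr 2
        ring

/-- If the means over a finite family of pairs are controlled by Chernoff's bound with rate
`min s s²`, then they are all small with high probability. -/
theorem measure_pi_exists_mean_gt_le {S I : Type*} [MeasurableSpace S] (κ : Measure S)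
    [IsProbabilityMeasure κ] {N : ℕ} (hN : 1 ≤ N) (I₀ : Finset I) {f : I → S → ℝ}
    (hf : ∀ i, Measurable (f i)) {θ b c K α δ : ℝ} (hθ : 0 ≤ θ) (hb : 0 ≤ b) (hα : 0 ≤ α)
    (hδ : 0 < δ)
    (hc : ∀ i ∈ I₀, ∀ t, 0 ≤ t → t ≤ θ →
      ∫⁻ x, ENNReal.ofReal (Real.exp (t * f i x)) ∂κ ≤ ENNReal.ofReal (Real.exp (b * t ^ 2)))
    (hrate : c ≤ 10 / 9 * θ - b * θ ^ 2) (hcard : (I₀.card : ℝ) ≤ Real.exp K)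
    (hK : K + Real.log (1 / δ) ≤ N * (c * α)) :
    Measure.pi (fun _ : Fin N => κ)
      {x | ∃ i ∈ I₀, 10 / 9 * max α (Real.sqrt α) < (N : ℝ)⁻¹ * ∑ j, f i (x j)} ≤
      ENNReal.ofReal δ := by
  set s := max α (Real.sqrt α)
  have hs : 0 ≤ s := le_max_of_le_left hα
  -- With `s = max α √α` one has `min s 1 * s = α` and `(min s 1)² ≤ α`, so this `t ≤ θ` yields an
  -- exponent of at least `(10/9 θ - b θ²) α` in both regimes.
  set t := θ * min s 1
  have hmin : 0 ≤ min s 1 := le_min hs zero_le_one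
  have ht0 : 0 ≤ t := mul_nonneg hθ hmin
  have ht1 : t ≤ θ := mul_le_of_le_one_right hθ (min_le_right _ _)
  have hexp : c * α ≤ t * (10 / 9 * s) - b * t ^ 2 := by
    have hms : min s 1 * s = α := by
      rcases le_total α 1 with h | h
      · have h1 : α ≤ Real.sqrt α := by
          rw [Real.le_sqrt hα hα]
          nlinarith
        rw [show s = Real.sqrt α from max_eq_right h1, min_eq_left (Real.sqrt_le_one.2 h),
          Real.mul_self_sqrt hα]
      · have h1 : Real.sqrt α ≤ α := by
          rw [Real.sqrt_le_left hα]
          nlinarith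
        rw [show s = α from max_eq_left h1, min_eq_right h, one_mul]
    have hsq : min s 1 ^ 2 ≤ α := by
      rw [← hms, sq]
      exact mul_le_mul_of_nonneg_left (min_le_left _ _) hmin
    have : t * (10 / 9 * s) - b * t ^ 2 = 10 / 9 * θ * (min s 1 * s) -
        b * θ ^ 2 * min s 1 ^ 2 := by
      simp only [t]; ring
    rw [this, hms]
    nlinarith [mul_le_mul_of_nonneg_left hsq (by positivity : 0 ≤ b * θ ^ 2),
      mul_le_mul_of_nonneg_right hrate hα]
  have hset : {x : Fin N → S | ∃ i ∈ I₀, 10 / 9 * s < (N : ℝ)⁻¹ * ∑ j, f i (x j)} =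
      ⋃ i ∈ I₀, {x | 10 / 9 * s < (N : ℝ)⁻¹ * ∑ j, f i (x j)} := by
    ext x; simp
  rw [hset]
  refine (measure_biUnion_finset_le _ _).trans ((Finset.sum_le_sum fun i hi =>
    measure_pi_mean_gt_le κ hN (hf i) ht0 (hc i hi t ht0 ht1)).trans ?_)
  rw [Finset.sum_const, nsmul_eq_mul, ← ENNReal.ofReal_natCast,
    ← ENNReal.ofReal_mul (by positivity)]
  refine ENNReal.ofReal_le_ofReal ?_
  calc _ ≤ Real.exp K * Real.exp (-(N * (t * (10 / 9 * s) - b * t ^ 2))) := by gcongr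
    _ ≤ Real.exp (Real.log δ) := by
        rw [← Real.exp_add, Real.exp_le_exp]
        rw [one_div, Real.log_inv] at hK
        have := mul_le_mul_of_nonneg_left hexp (Nat.cast_nonneg (α := ℝ) N)
        linarith
    _ = δ := Real.exp_log hδ

/-! ### Tail bounds for the multilinear norms of the three errors. -/

theorem norm_rankOne_le_one {v : (k : Fin r) → EuclideanSpace ℝ (Fin (n k))}
    (hv : ∀ k, ‖v k‖ ≤ 1) : ‖rankOne v‖ ≤ 1 := by
  rw [← sq_le_one_iff₀ (norm_nonneg _), EuclideanSpace.real_norm_sq_eq]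
  have : ∑ i, (rankOne v) i ^ 2 = ∏ k, ‖v k‖ ^ 2 := by
    simp only [EuclideanSpace.real_norm_sq_eq, Finset.prod_univ_sum, Fintype.piFinset_univ,
      rankOne, Finset.prod_pow]
  rw [this]
  exact Finset.prod_le_one (fun _ _ => by positivity) fun k _ =>
    pow_le_one₀ (norm_nonneg _) (hv k)

/-- High-probability bound on `‖S - I‖_ml` for the sample covariance of standard Gaussian
tensors obtained as a function `g` of the samples. -/
theorem measure_mlNorm_crossCovariance_sub_id_gt_le {S : Type*} [MeasurableSpace S]
    (κ : Measure S) [IsProbabilityMeasure κ] (hr : 1 ≤ r) {N : ℕ} (hN : 1 ≤ N)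
    {g : S → Tensor n} (hg : Measurable g) (hlaw : κ.map g = stdGaussian (Tensor n)) {α δ : ℝ}
    (hδ : 0 < δ) (hα0 : 0 ≤ α)
    (hα : α = 1 / (0.145 * N) * (2 * Real.log (10 * r) * ∑ k, (n k : ℝ) + Real.log (1 / δ))) :
    Measure.pi (fun _ : Fin N => κ) {x | 2 * max α (Real.sqrt α) <
      mlNorm (crossCovariance (fun i => g (x i)) (fun i => g (x i)) - LinearMap.id)} ≤
      ENNReal.ofReal δ := by
  obtain ⟨s, hs1, hsc, hsn⟩ := exists_net_pi hr n
  have hr' : (1 : ℝ) ≤ r := by exact_mod_cast hr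
  have hN' : (N : ℝ) ≠ 0 := by positivity
  let f : ((k : Fin r) → EuclideanSpace ℝ (Fin (n k))) ×
      ((k : Fin r) → EuclideanSpace ℝ (Fin (n k))) → S → ℝ := fun p x =>
    inner ℝ (g x) (rankOne p.1) * inner ℝ (g x) (rankOne p.2) -
      inner ℝ (rankOne p.1) (rankOne p.2)
  -- The rate is `10/9 · 1/5 - 5/3 · 1/25 = 7/45 ≥ 0.145`; the factor `10/9` is what becomes `2`
  -- after the net loss `9/5`.
  refine (measure_mono ?_).trans (measure_pi_exists_mean_gt_le κ hN (s ×ˢ s) (f := f)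
    (fun p => by fun_prop) (θ := 1 / 5) (b := 5 / 3) (c := 0.145)
    (K := 2 * Real.log (10 * r) * ∑ k, (n k : ℝ)) (α := α) (δ := δ) (by norm_num) (by norm_num)
    hα0 hδ ?_ (by norm_num) ?_ (le_of_eq ?_))
  · intro x hx
    by_contra hcon
    simp only [Set.mem_ofPred_eq, not_exists, not_and, not_lt] at hx hcon
    have := mlNorm_le_of_nets hr
      (crossCovariance (fun i => g (x i)) (fun i => g (x i)) - LinearMap.id)
      (two_mul_mul_net_radius_le hr) (div_nonneg two_pos.le (by linarith)) s s hsn hsn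
      (c := 10 / 9 * max α (Real.sqrt α)) fun u hu v hv => by
        rw [inner_crossCovariance_sub_id hN]
        exact hcon (u, v) (Finset.mem_product.2 ⟨hu, hv⟩)
    linarith
  · intro p hp t ht0 ht
    have hp' := Finset.mem_product.1 hp
    have := lintegral_exp_inner_mul_inner_le (norm_rankOne_le_one (hs1 _ hp'.1))
      (norm_rankOne_le_one (hs1 _ hp'.2)) (t := t) (by rwa [abs_of_nonneg ht0])
    rwa [← hlaw, lintegral_map (by fun_prop) hg] at this
  · rw [Finset.card_product, Nat.cast_mul, mul_assoc, two_mul, Real.exp_add]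
    gcongr
  · rw [hα]
    field_simp

/-- High-probability bound on the cross covariance of independent standard Gaussian tensors. -/
theorem measure_mlNorm_crossCovariance_gt_le (hr : 1 ≤ r) {N : ℕ} (hN : 1 ≤ N) {α δ : ℝ}
    (hδ : 0 < δ) (hα0 : 0 ≤ α)
    (hα : α = 3 / N *
      (Real.log (10 * r) * ∑ k, ((n k : ℝ) + (m k : ℝ)) + Real.log (1 / δ))) :
    Measure.pi (fun _ : Fin N => (stdGaussian (Tensor m)).prod (stdGaussian (Tensor n)))
      {x | 2 * max α (Real.sqrt α) <
        mlNorm (crossCovariance (fun i => (x i).1) (fun i => (x i).2))} ≤ ENNReal.ofReal δ := by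
  obtain ⟨s, hs1, hsc, hsn⟩ := exists_net_pi hr n
  obtain ⟨s', hs1', hsc', hsn'⟩ := exists_net_pi hr m
  have hr' : (1 : ℝ) ≤ r := by exact_mod_cast hr
  have hN' : (N : ℝ) ≠ 0 := by positivity
  let f : ((k : Fin r) → EuclideanSpace ℝ (Fin (n k))) ×
      ((k : Fin r) → EuclideanSpace ℝ (Fin (m k))) → Tensor m × Tensor n → ℝ := fun p x =>
    inner ℝ x.2 (rankOne p.1) * inner ℝ x.1 (rankOne p.2)
  -- Here the rate is `10/9 · 1/2 - 2/3 · 1/4 = 7/18 ≥ 1/3`.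
  refine (measure_mono ?_).trans (measure_pi_exists_mean_gt_le _ hN (s ×ˢ s') (f := f)
    (fun p => by fun_prop) (θ := 1 / 2) (b := 2 / 3) (c := 1 / 3)
    (K := Real.log (10 * r) * ∑ k, ((n k : ℝ) + (m k : ℝ))) (α := α) (δ := δ) (by norm_num)
    (by norm_num) hα0 hδ ?_ (by norm_num) ?_ (le_of_eq ?_))
  · intro x hx
    by_contra hcon
    simp only [Set.mem_ofPred_eq, not_exists, not_and, not_lt] at hx hcon
    have := mlNorm_le_of_nets hr (crossCovariance (fun i => (x i).1) (fun i => (x i).2))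
      (two_mul_mul_net_radius_le hr) (div_nonneg two_pos.le (by linarith)) s s' hsn hsn'
      (c := 10 / 9 * max α (Real.sqrt α)) fun u hu v hv => by
        rw [inner_crossCovariance]
        exact hcon (u, v) (Finset.mem_product.2 ⟨hu, hv⟩)
    linarith
  · intro p hp t ht0 ht
    have hp' := Finset.mem_product.1 hp
    exact lintegral_exp_inner_mul_inner_prod_le (norm_rankOne_le_one (hs1' _ hp'.2))
      (norm_rankOne_le_one (hs1 _ hp'.1)) (t := t) (by rwa [abs_of_nonneg ht0])
  · rw [Finset.card_product, Nat.cast_mul, Finset.sum_add_distrib, mul_add, Real.exp_add]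
    gcongr
  · rw [hα]
    field_simp

/-! ### From the model to standard Gaussian samples. -/

variable {Ω : Type*} [MeasurableSpace Ω]

theorem IsGaussian.aemeasurable {P : Measure Ω} {X : Ω → Tensor n} {μ : Tensor n}
    {C : Tensor n →ₗ[ℝ] Tensor n} (h : IsGaussian P X μ C) : AEMeasurable X P := by
  have h1 : ∀ i, AEMeasurable (fun ω => X ω i) P := fun i => by
    have := (h.hasLaw (EuclideanSpace.single i 1)).aemeasurable
    simpa [EuclideanSpace.inner_single_right] using this
  have h2 : AEMeasurable (fun ω i => X ω i) P := aemeasurable_pi_lambda _ h1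
  exact (WithLp.measurable_toLp 2 _).comp_aemeasurable h2

/-- A Gaussian tensor with covariance `σ² I` has the law of `σ` times a standard one. -/
theorem IsGaussian.map_eq {P : Measure Ω} [IsProbabilityMeasure P] {X : Ω → Tensor n} {σ : ℝ}
    (h : IsGaussian P X 0 (σ ^ 2 • LinearMap.id)) :
    P.map X = (stdGaussian (Tensor n)).map fun x => σ • x := by
  have hX := h.aemeasurable
  have : IsProbabilityMeasure (P.map X) := Measure.isProbabilityMeasure_map hX
  have : IsProbabilityMeasure ((stdGaussian (Tensor n)).map fun x => σ • x) :=
    Measure.isProbabilityMeasure_map (by fun_prop)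
  refine Measure.ext_of_charFun (funext fun T => ?_)
  rw [charFun_map_smul, charFun_stdGaussian, charFun_apply, integral_map hX (by fun_prop)]
  have h1 := (h.hasLaw T).map_eq
  -- The characteristic function of `X` at `T` is that of the scalar `⟪X, T⟫` at `1`, so the scalar
  -- laws determine the law of `X`.
  have h2 := charFun_gaussianReal (μ := inner ℝ (0 : Tensor n) T)
    (v := (inner ℝ ((σ ^ 2 • LinearMap.id : Tensor n →ₗ[ℝ] Tensor n) T) T).toNNReal) 1
  rw [← h1, charFun_apply_real, integral_map (h.hasLaw T).aemeasurable (by fun_prop)] at h2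
  simp only [Complex.ofReal_one, one_mul] at h2
  rw [h2, Real.coe_toNNReal _ (by
    simp only [LinearMap.smul_apply, LinearMap.id_apply, real_inner_smul_left,
      real_inner_self_eq_norm_sq]
    positivity)]
  simp [real_inner_smul_left, norm_smul, mul_pow, neg_div, ← Complex.ofReal_pow]

/-- The law of the probabilistic tensor PCA model. -/
theorem FollowsModel.map_eq {P : Measure Ω} [IsProbabilityMeasure P]
    {A : (k : Fin r) → Matrix (Fin (n k)) (Fin (m k)) ℝ} {ν : Tensor m} {σ : ℝ}
    {X : Ω → Tensor n} (h : FollowsModel P A ν σ X) :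
    AEMeasurable X P ∧ P.map X = ((stdGaussian (Tensor m)).prod (stdGaussian (Tensor n))).map
      fun x => tucker A ν + tucker A x.1 + σ • x.2 := by
  obtain ⟨Z, ε, hZ, hε, hind, hX⟩ := h
  have hA : Continuous (tucker A) := (tucker A).continuous_of_finiteDimensional
  have hZm := hZ.aemeasurable
  have hεm := hε.aemeasurable
  have hZ' : IsGaussian P Z 0 ((1 : ℝ) ^ 2 • LinearMap.id) := by simpa using hZ
  have hZlaw : P.map Z = stdGaussian (Tensor m) := by simpa using hZ'.map_eq
  have hprod : P.map (fun ω => (Z ω, ε ω)) =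
      (stdGaussian (Tensor m)).prod ((stdGaussian (Tensor n)).map fun x => σ • x) := by
    rw [(indepFun_iff_map_prod_eq_prod_map_map hZm hεm).1 hind, hZlaw, hε.map_eq]
  have hφ : Measurable fun x : Tensor m × Tensor n => tucker A ν + tucker A x.1 + x.2 := by
    have : Continuous fun x : Tensor m × Tensor n => tucker A ν + tucker A x.1 + x.2 := by
      fun_prop
    exact this.measurable
  have hX' : X =ᵐ[P] (fun x : Tensor m × Tensor n => tucker A ν + tucker A x.1 + x.2) ∘
      fun ω => (Z ω, ε ω) := hX
  refine ⟨(hφ.comp_aemeasurable (hZm.prodMk hεm)).congr hX'.symm, ?_⟩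
  rw [Measure.map_congr hX', ← AEMeasurable.map_map_of_aemeasurable hφ.aemeasurable
    (hZm.prodMk hεm), hprod]
  have hsm : Measurable fun x : Tensor n => σ • x := by fun_prop
  have : IsProbabilityMeasure ((stdGaussian (Tensor n)).map fun x => σ • x) :=
    Measure.isProbabilityMeasure_map hsm.aemeasurable
  rw [← Measure.map_id (μ := stdGaussian (Tensor m)),
    Measure.map_prod_map _ _ measurable_id hsm, Measure.map_map hφ (by fun_prop), Measure.map_id]
  rfl

/-- An intersection of closed conditions, one for each pair of rank-one tensors. It supplies the
measurability needed to transfer the event between laws. -/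
theorem isClosed_mlNorm_sub_le {N : ℕ} (μ : Tensor n) (C : Tensor n →ₗ[ℝ] Tensor n) (t : ℝ) :
    IsClosed {x : Fin N → Tensor n | mlNorm (sampleCovariance μ x - C) ≤ t} := by
  have : {x : Fin N → Tensor n | mlNorm (sampleCovariance μ x - C) ≤ t} =
      ⋂ (u : (k : Fin r) → EuclideanSpace ℝ (Fin (n k))) (_ : ∀ k, ‖u k‖ ≤ 1)
        (v : (k : Fin r) → EuclideanSpace ℝ (Fin (n k))) (_ : ∀ k, ‖v k‖ ≤ 1),
        {x | inner ℝ ((sampleCovariance μ x - C) (rankOne u)) (rankOne v) ≤ t} := by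
    ext x
    simp only [Set.mem_ofPred_eq, Set.mem_iInter]
    exact ⟨fun h u hu v hv => (inner_le_mlNorm _ hu hv).trans h,
      fun h => mlNorm_le fun u v hu hv => h u hu v hv⟩
  rw [this]
  refine isClosed_iInter fun u => isClosed_iInter fun _ => isClosed_iInter fun v =>
    isClosed_iInter fun _ => isClosed_le ?_ continuous_const
  simp only [sampleCovariance, outer, LinearMap.sub_apply, LinearMap.smul_apply,
    LinearMap.sum_apply, LinearMap.smulRight_apply, innerₗ_apply_apply]
  fun_prop

/-- Transfer of a probability from samples of the model to standard Gaussian samples. -/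
theorem measure_model_eq {P : Measure Ω} [IsProbabilityMeasure P] {N : ℕ}
    {A : (k : Fin r) → Matrix (Fin (n k)) (Fin (m k)) ℝ} {ν : Tensor m} {σ : ℝ}
    {X : Fin N → Ω → Tensor n} (hX : ∀ i, FollowsModel P A ν σ (X i)) (hind : iIndepFun X P)
    {B : Set (Fin N → Tensor n)} (hB : MeasurableSet B) :
    P {ω | (fun i => X i ω) ∈ B} =
      Measure.pi (fun _ : Fin N => (stdGaussian (Tensor m)).prod (stdGaussian (Tensor n)))
        {x | (fun i => tucker A ν + tucker A (x i).1 + σ • (x i).2) ∈ B} := by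
  have hA : Continuous (tucker A) := (tucker A).continuous_of_finiteDimensional
  have hφ : Measurable fun x : Tensor m × Tensor n => tucker A ν + tucker A x.1 + σ • x.2 := by
    have : Continuous fun x : Tensor m × Tensor n => tucker A ν + tucker A x.1 + σ • x.2 := by
      fun_prop
    exact this.measurable
  have h1 := hind.map_fun_eq_pi_map fun i => (hX i).map_eq.1
  simp only [fun i => (hX i).map_eq.2] at h1
  have : IsProbabilityMeasure (((stdGaussian (Tensor m)).prod (stdGaussian (Tensor n))).map
      fun x => tucker A ν + tucker A x.1 + σ • x.2) :=
    Measure.isProbabilityMeasure_map hφ.aemeasurable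
  rw [← Measure.pi_map_pi fun _ => hφ.aemeasurable] at h1
  have h2 := congrArg (fun M => M B) h1
  have hA' : Measurable (tucker A) := hA.measurable
  rw [Measure.map_apply_of_aemeasurable (aemeasurable_pi_lambda _ fun i => (hX i).map_eq.1) hB,
    Measure.map_apply (by fun_prop) hB] at h2
  exact h2

end TPCA

/-! ### The main theorem. -/

theorem mainTheorem3 {Ω : Type*} [MeasurableSpace Ω] (P : Measure Ω) [IsProbabilityMeasure P]
    {r N : ℕ} (hr : 1 ≤ r) (hN : 1 ≤ N) (n m : Fin r → ℕ)
    (A : (k : Fin r) → Matrix (Fin (n k)) (Fin (m k)) ℝ)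
    (ν : TPCA.Tensor m) (σ : ℝ) (hσ : 0 ≤ σ)
    (X : Fin N → Ω → TPCA.Tensor n)
    (hX : ∀ i, TPCA.FollowsModel P A ν σ (X i))
    (hindep : iIndepFun X P)
    (δ₁ δ₂ δ₃ : ℝ) (hδ₁ : 0 < δ₁) (hδ₂ : 0 < δ₂) (hδ₃ : 0 < δ₃)
    (α₁ α₂ α₃ t₁ t₂ t₃ : ℝ)
    (hα₁ : α₁ = 1 / (0.145 * N) *
      (2 * Real.log (10 * r) * ∑ k, (n k : ℝ) + Real.log (1 / δ₁)))
    (hα₂ : α₂ = 1 / (0.145 * N) *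
      (2 * Real.log (10 * r) * ∑ k, (m k : ℝ) + Real.log (1 / δ₂)))
    (hα₃ : α₃ = 3 / N *
      (Real.log (10 * r) * ∑ k, ((n k : ℝ) + (m k : ℝ)) + Real.log (1 / δ₃)))
    (ht₁ : t₁ = 2 * σ ^ 2 * max α₁ (Real.sqrt α₁))
    (ht₂ : t₂ = 2 * TPCA.prodNorm A ^ 2 * max α₂ (Real.sqrt α₂))
    (ht₃ : t₃ = 4 * σ * TPCA.prodNorm A * max α₃ (Real.sqrt α₃)) :
    1 - δ₁ - δ₂ - δ₃ ≤
      P.real {ω | TPCA.mlNorm (TPCA.sampleCovariance (TPCA.tucker A ν) (fun i => X i ω) -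
        TPCA.covariance A σ) ≤ t₁ + t₂ + t₃} := by
  -- Outside this trivial case every `δ` is at most `1`, so the `α` are nonnegative, as the tail
  -- bounds require.
  by_cases hδ : 1 - δ₁ - δ₂ - δ₃ ≤ 0
  · exact hδ.trans measureReal_nonneg
  have hr' : (1 : ℝ) ≤ r := by exact_mod_cast hr
  have hlog : 0 ≤ Real.log (10 * r) := Real.log_nonneg (by linarith)
  have hlogδ : ∀ δ : ℝ, 0 < δ → δ ≤ 1 → 0 ≤ Real.log (1 / δ) := fun δ h0 h1 =>
    Real.log_nonneg (by rwa [le_div_iff₀ h0, one_mul])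
  have hl₁ := hlogδ δ₁ hδ₁ (by linarith)
  have hl₂ := hlogδ δ₂ hδ₂ (by linarith)
  have hl₃ := hlogδ δ₃ hδ₃ (by linarith)
  have hα₁0 : 0 ≤ α₁ := by rw [hα₁]; positivity
  have hα₂0 : 0 ≤ α₂ := by rw [hα₂]; positivity
  have hα₃0 : 0 ≤ α₃ := by rw [hα₃]; positivity
  set κ := (stdGaussian (TPCA.Tensor m)).prod (stdGaussian (TPCA.Tensor n))
  set Q := Measure.pi fun _ : Fin N => κ
  let B₁ : Set (Fin N → TPCA.Tensor m × TPCA.Tensor n) := {x | 2 * max α₁ (Real.sqrt α₁) <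
    TPCA.mlNorm (TPCA.crossCovariance (fun i => (x i).2) (fun i => (x i).2) - LinearMap.id)}
  let B₂ : Set (Fin N → TPCA.Tensor m × TPCA.Tensor n) := {x | 2 * max α₂ (Real.sqrt α₂) <
    TPCA.mlNorm (TPCA.crossCovariance (fun i => (x i).1) (fun i => (x i).1) - LinearMap.id)}
  let B₃ : Set (Fin N → TPCA.Tensor m × TPCA.Tensor n) := {x | 2 * max α₃ (Real.sqrt α₃) <
    TPCA.mlNorm (TPCA.crossCovariance (fun i => (x i).1) (fun i => (x i).2))}
  have b₁ : Q B₁ ≤ ENNReal.ofReal δ₁ :=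
    TPCA.measure_mlNorm_crossCovariance_sub_id_gt_le κ hr hN measurable_snd
      (by simp [κ, Measure.map_snd_prod]) hδ₁ hα₁0 hα₁
  have b₂ : Q B₂ ≤ ENNReal.ofReal δ₂ :=
    TPCA.measure_mlNorm_crossCovariance_sub_id_gt_le κ hr hN measurable_fst
      (by simp [κ, Measure.map_fst_prod]) hδ₂ hα₂0 hα₂
  have b₃ : Q B₃ ≤ ENNReal.ofReal δ₃ :=
    TPCA.measure_mlNorm_crossCovariance_gt_le hr hN hδ₃ hα₃0 hα₃
  have hmeas := (TPCA.isClosed_mlNorm_sub_le (N := N) (TPCA.tucker A ν) (TPCA.covariance A σ)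
    (t₁ + t₂ + t₃)).measurableSet
  have htrans : P.real {ω | TPCA.mlNorm (TPCA.sampleCovariance (TPCA.tucker A ν)
      (fun i => X i ω) - TPCA.covariance A σ) ≤ t₁ + t₂ + t₃} =
      Q.real {x | TPCA.mlNorm (TPCA.sampleCovariance (TPCA.tucker A ν)
        (fun i => TPCA.tucker A ν + TPCA.tucker A (x i).1 + σ • (x i).2) -
          TPCA.covariance A σ) ≤ t₁ + t₂ + t₃} :=
    congrArg ENNReal.toReal (TPCA.measure_model_eq hX hindep hmeas)
  set G := {x : Fin N → TPCA.Tensor m × TPCA.Tensor n |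
    TPCA.mlNorm (TPCA.sampleCovariance (TPCA.tucker A ν)
      (fun i => TPCA.tucker A ν + TPCA.tucker A (x i).1 + σ • (x i).2) -
        TPCA.covariance A σ) ≤ t₁ + t₂ + t₃}
  -- Covering the whole space, rather than taking complements, needs only subadditivity and hence no
  -- measurability of the bad events.
  have hcover : (Set.univ : Set (Fin N → TPCA.Tensor m × TPCA.Tensor n)) ⊆
      G ∪ (B₁ ∪ B₂ ∪ B₃) := by
    intro x _
    by_contra hx
    simp only [Set.mem_union, not_or, B₁, B₂, B₃, Set.mem_ofPred_eq, not_lt] at hx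
    obtain ⟨hG, ⟨h₁, h₂⟩, h₃⟩ := hx
    refine hG ((TPCA.mlNorm_sampleCovariance_sub_le hr A hσ _ (fun i => (x i).1)
      fun i => (x i).2).trans ?_)
    have hA := TPCA.prodNorm_nonneg A
    have g₁ := mul_le_mul_of_nonneg_left h₁ (sq_nonneg σ)
    have g₂ := mul_le_mul_of_nonneg_left h₂ (sq_nonneg (TPCA.prodNorm A))
    have g₃ := mul_le_mul_of_nonneg_left h₃ (by positivity : 0 ≤ 2 * σ * TPCA.prodNorm A)
    rw [ht₁, ht₂, ht₃]
    linarith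
  have toReal_le : ∀ {B : Set (Fin N → TPCA.Tensor m × TPCA.Tensor n)} {δ : ℝ}, 0 < δ →
      Q B ≤ ENNReal.ofReal δ → Q.real B ≤ δ := fun h hB =>
    ENNReal.toReal_le_of_le_ofReal h.le hB
  have htot : 1 ≤ Q.real G + (Q.real B₁ + Q.real B₂ + Q.real B₃) := by
    calc (1 : ℝ) = Q.real Set.univ := probReal_univ.symm
      _ ≤ Q.real (G ∪ (B₁ ∪ B₂ ∪ B₃)) := measureReal_mono hcover
      _ ≤ Q.real G + Q.real (B₁ ∪ B₂ ∪ B₃) := measureReal_union_le _ _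
      _ ≤ Q.real G + (Q.real B₁ + Q.real B₂ + Q.real B₃) := by
        gcongr
        refine (measureReal_union_le _ _).trans ?_
        gcongr
        exact measureReal_union_le _ _
  rw [htrans]
  linarith [toReal_le hδ₁ b₁, toReal_le hδ₂ b₂, toReal_le hδ₃ b₃]
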